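/- Let $\mathcal B_c$ be the set of continuous $F:\mathbb R\to\mathbb R$ such that $\lim_{x\to-\infty}F(x)=0$ and $F(\infty)=\lim_{x\to\infty}F(x)$ exists in $\mathbb R$. Let $\mathcal A_c$ be the set of distributions $f\in\mathcal D'(\mathbb R)$ that are the distributional derivative $f=F'$ of some $F\in\mathcal B_c$; this primitive $F$ is unique, and the Alexiewicz norm of $f$ is $\|f\|=\sup_{x<y}|F(y)-F(x)|$. For $g$ absolutely continuous and of bounded variation put $\int_{-\infty}^\infty fg=F(\infty)g(\infty)-\int_{-\infty}^\infty F(x)g'(x)\,dx$, where $g(\infty)=\lim_{x\to\infty}g(x)$. Let $\Theta_t(x)=(4\pi t)^{-1/2}e^{-x^2/(4t)}$ for $t>0$, and $f\ast\Theta_t(x)=\int_{-\infty}^\infty f(\xi)\Theta_t(x-\xi)\,d\xi$ in this sense. Locally integrable functions are identified with distributions. **Theorem (Uniqueness in $\mathcal A_c$).** Let $f\in\mathcal A_c$. Consider functions $u:\mathbb R\times(0,\infty)\to\mathbb R$, with $u_t(x)=u(x,t)$, such that 1. $u$ is a classical solution of the heat equation: $u$ is continuous on $\mathbb R\times(0,\infty)$,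 $u(\cdot,t)\in C^2(\mathbb R)$ for each $t>0$, $u(x,\cdot)\in C^1((0,\infty))$ for each $x\in\mathbb R$, and $\partial u/\partial t=\partial^2u/\partial x^2$ at every point of $\mathbb R\times(0,\infty)$; 2. $u_t\in\mathcal A_c$ for each $t>0$, and $\|u_t\|$ is bounded for $t\in(0,\infty)$; 3. $\|u_t-f\|\to0$ as $t\to0^+$. Then $u(x,t)=f\ast\Theta_t(x)$ is such a function, and it is the only one: every $u$ with these properties satisfies $u(x,t)=f\ast\Theta_t(x)$ for all $x\in\mathbb R$ and $t>0$. -/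

import Mathlib

open Set Filter Topology MeasureTheory
open scoped Distributions LineDeriv

noncomputable section

namespace AlexHeat

/-- Real-valued Schwartz distributions on the line, the dual of `C_c^∞(ℝ)`. -/
abbrev Distr : Type := 𝓓'((⊤ : TopologicalSpace.Opens ℝ), ℝ)

/-- The distribution `T_g : φ ↦ ∫ φ g` of a locally integrable function `g` (and zero if `g` is
not locally integrable). -/
def ofFun (g : ℝ → ℝ) : Distr :=
  ContinuousLinearMap.toUniformConvergenceCLM (RingHom.id ℝ) ℝ {S | IsCompact S}
    (TestFunction.integralAgainstBilinCLM (ContinuousLinearMap.mul ℝ ℝ) volume g)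

/-- The space `𝓑_c` of primitives: continuous functions on the extended real line, with real limits
at `±∞`, the limit at `-∞` being `0`. -/
structure IsPrimitiveFun (F : ℝ → ℝ) : Prop where
  continuous : Continuous F
  tendsto_atBot : Tendsto F atBot (𝓝 0)
  exists_tendsto_atTop : ∃ L : ℝ, Tendsto F atTop (𝓝 L)

/-- `F ∈ 𝓑_c` is a primitive of the distribution `f`: the distributional derivative of `F` is
`f`. -/
def HasPrimitive (f : Distr) (F : ℝ → ℝ) : Prop :=
  IsPrimitiveFun F ∧ ∂_{(1 : ℝ)} (ofFun F) = f

/-- The space `𝓐_c` of distributions that are integrable in the sense of the continuous primitive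
integral. -/
def Ac : Set Distr := {f | ∃ F : ℝ → ℝ, HasPrimitive f F}

open Classical in
/-- The primitive in `𝓑_c` (it is unique) of a distribution in `𝓐_c`. -/
def primitive (f : Distr) : ℝ → ℝ :=
  if h : f ∈ Ac then h.choose else 0

/-- The Alexiewicz norm `‖f‖ = sup_{x<y} |∫_x^y f| = sup_{x<y} |F y - F x|` of a distribution
`f ∈ 𝓐_c` with primitive `F`. It is only meaningful for `f ∈ 𝓐_c`. -/
def alexNorm (f : Distr) : ℝ :=
  sSup {r : ℝ | ∃ x y : ℝ, x < y ∧ r = |primitive f y - primitive f x|}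

/-- The continuous primitive integral `∫ f g` over the line for `f ∈ 𝓐_c` with primitive `F` and an
absolutely continuous multiplier `g` of bounded variation:
`∫ f g = F(∞) g(∞) - ∫ F(x) g'(x) dx`. -/
def integralMul (f : Distr) (g : ℝ → ℝ) : ℝ :=
  limUnder atTop (primitive f) * limUnder atTop g - ∫ x : ℝ, primitive f x * deriv g x

/-- The Gauss-Weierstrass heat kernel `Θ_t(x)`. -/
def heatKernel (t x : ℝ) : ℝ :=
  Real.exp (-x ^ 2 / (4 * t)) / Real.sqrt (4 * Real.pi * |t|)

/-- The convolution `f ∗ Θ_t (x) = ∫ f(ξ) Θ_t(x - ξ) dξ`, for `f ∈ 𝓐_c`, as a continuous primitive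
integral. -/
def heatConv (f : Distr) (x t : ℝ) : ℝ :=
  integralMul f (fun ξ => heatKernel t (x - ξ))

/-- `u` is a classical solution of the heat equation on `ℝ × (0,∞)`: it is continuous there, `C²`
in the space variable, `C¹` in the time variable, and `u_t = u_xx` at every point. Only the values
`u x t` with `t > 0` matter. -/
structure IsClassicalSolution (u : ℝ → ℝ → ℝ) : Prop where
  continuousOn : ContinuousOn (fun p : ℝ × ℝ => u p.1 p.2) (univ ×ˢ Ioi 0)
  contDiff_space : ∀ t : ℝ, 0 < t → ContDiff ℝ 2 (fun x => u x t)
  contDiffOn_time : ∀ x : ℝ, ContDiffOn ℝ 1 (fun t => u x t) (Ioi 0)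
  heat_eq : ∀ x t : ℝ, 0 < t → deriv (fun s => u x s) t = deriv (deriv (fun y => u y t)) x

/-- The initial value problem with data `f` in the Alexiewicz norm: `u` is a classical solution of
the heat equation, all `u_t` lie in `𝓐_c`, `‖u_t‖` is bounded over `t > 0`, and `‖u_t - f‖ → 0` as
`t → 0⁺`. -/
structure IsAlexSolution (f : Distr) (u : ℝ → ℝ → ℝ) : Prop where
  classical : IsClassicalSolution u
  mem_Ac : ∀ t : ℝ, 0 < t → ofFun (fun x => u x t) ∈ Ac
  bounded : ∃ M : ℝ, ∀ t : ℝ, 0 < t → alexNorm (ofFun (fun x => u x t)) ≤ M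
  initial : Tendsto (fun t : ℝ => alexNorm (ofFun (fun x => u x t) - f)) (𝓝[>] 0) (𝓝 0)

end AlexHeat

end

/-!
Write `a = 1 / (4 t)`, and let `F` be the primitive of `f`, which is unique because a continuous
function with zero distributional derivative is constant.

*Existence.* By the definition of the integral, `f ∗ Θ_t` is a multiple of the convolution of `F`
with `z exp (-a z²)`. All derivatives of such convolutions are combinations of the functions
`gaussMoment F k x a`, the convolutions of `F` with `z ^ k exp (-a z²)`, whose derivatives in `x`
and `a` are found by dominated differentiation under the integral; this gives the regularity and the
heat equation. The primitive of `f ∗ Θ_t` is `F ∗ Θ_t` (`hasPrimitive_heatConv`). It is bounded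
uniformly in `t`, and converges uniformly to `F` because `F`, having limits at both ends, is bounded
and uniformly continuous, hence satisfies `|F ξ - F x| ≤ ε + C (x - ξ)²`, while the second moment
of `Θ_t` is `2 t`.

*Uniqueness.* Let `v` be the difference of two solutions. Its averages
`W x t = ∫ y in x..(x + h), v y t` are increments of the primitive of `v_t`, so they are bounded by
Alexiewicz norms: they are bounded for `t > 0`, and tend to `0` uniformly in `x` as `t → 0⁺`. The
maximum principle then gives `W = 0` for every `h`, whence `v = 0`. Since the derivatives of `v`
are not assumed to be jointly continuous, `W` cannot be differentiated in `t` under the integral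
sign. Instead, the maximum principle is applied to the Riemann sums of `W`, which are finite
combinations of translates of `v` and so classical solutions, and which converge to `W` uniformly
on rectangles (`IsClassicalSolution.exists_approx_average`). The barrier `ε (x² + 3 t)` takes care
of the unbounded domain.
-/

/-! ### Distributional derivatives of continuous functions -/

namespace AlexHeat

lemma ofFun_apply {g : ℝ → ℝ} (hg : Continuous g)
    (φ : 𝓓((⊤ : TopologicalSpace.Opens ℝ), ℝ)) : ofFun g φ = ∫ x, φ x * g x := by
  have h : LocallyIntegrableOn g ((⊤ : TopologicalSpace.Opens ℝ) : Set ℝ) volume :=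
    hg.locallyIntegrable.locallyIntegrableOn _
  change TestFunction.integralAgainstBilinCLM (ContinuousLinearMap.mul ℝ ℝ) volume g φ = _
  rw [TestFunction.integralAgainstBilinCLM_eq_integral h]
  simp

lemma lineDeriv_ofFun_apply {g : ℝ → ℝ} (hg : Continuous g)
    (φ : 𝓓((⊤ : TopologicalSpace.Opens ℝ), ℝ)) :
    (∂_{(1 : ℝ)} (ofFun g)) φ = -∫ x, deriv φ x * g x := by
  rw [Distribution.lineDerivOp_apply_apply, map_neg, ofFun_apply hg]
  rfl

lemma ofFun_sub {g₁ g₂ : ℝ → ℝ} (h₁ : Continuous g₁) (h₂ : Continuous g₂) :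
    ofFun (fun x => g₁ x - g₂ x) = ofFun g₁ - ofFun g₂ := by
  ext φ
  have e : (ofFun g₁ - ofFun g₂) φ = ofFun g₁ φ - ofFun g₂ φ := rfl
  rw [e, ofFun_apply (g := fun x => g₁ x - g₂ x) (h₁.sub h₂), ofFun_apply h₁,
    ofFun_apply h₂, ← integral_sub]
  · simp [mul_sub]
  · exact (φ.continuous.mul h₁).integrable_of_hasCompactSupport φ.hasCompactSupport.mul_right
  · exact (φ.continuous.mul h₂).integrable_of_hasCompactSupport φ.hasCompactSupport.mul_right

lemma lineDeriv_ofFun_of_hasDerivAt {P g : ℝ → ℝ} (hg : Continuous g)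
    (hP : ∀ x, HasDerivAt P (g x) x) : ∂_{(1 : ℝ)} (ofFun P) = ofFun g := by
  have hPc : Continuous P := continuous_iff_continuousAt.2 fun x => (hP x).continuousAt
  ext φ
  have hφ : ContDiff ℝ 1 φ := φ.contDiff.of_le (mod_cast le_top)
  have hφ' : Continuous (deriv φ) := hφ.continuous_deriv le_rfl
  rw [lineDeriv_ofFun_apply hPc, ofFun_apply hg]
  rw [← integral_mul_deriv_eq_deriv_mul_of_integrable (u := φ) (v := P) (u' := deriv φ) (v' := g)]
  · exact fun x _ => (hφ.differentiable one_ne_zero).differentiableAt.hasDerivAt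
  · exact fun x _ => hP x
  · exact (φ.continuous.mul hg).integrable_of_hasCompactSupport φ.hasCompactSupport.mul_right
  · exact (hφ'.mul hPc).integrable_of_hasCompactSupport φ.hasCompactSupport.deriv.mul_right
  · exact (φ.continuous.mul hPc).integrable_of_hasCompactSupport φ.hasCompactSupport.mul_right

/-- The difference `ψ - ψ(· - h)` of a test function and its translate is the derivative of a
test function, namely of `x ↦ ∫ y in (x - h)..x, ψ y`. -/
lemma exists_testFunction_deriv_eq_sub_translate {ψ : ℝ → ℝ} (hψ : ContDiff ℝ (⊤ : ℕ∞) ψ)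
    (hs : HasCompactSupport ψ) (h : ℝ) :
    ∃ φ : 𝓓((⊤ : TopologicalSpace.Opens ℝ), ℝ), ∀ x, deriv φ x = ψ x - ψ (x - h) := by
  set Ψ : ℝ → ℝ := fun x => ∫ y in (0 : ℝ)..x, ψ y with hΨ
  have hd : ∀ x, HasDerivAt Ψ (ψ x) x := fun x =>
    intervalIntegral.integral_hasDerivAt_right (hψ.continuous.intervalIntegrable _ _)
      (hψ.continuous.stronglyMeasurableAtFilter _ _) hψ.continuous.continuousAt
  have hΨs : ContDiff ℝ (⊤ : ℕ∞) Ψ := by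
    rw [contDiff_infty_iff_deriv]
    refine ⟨fun x => (hd x).differentiableAt, ?_⟩
    rwa [show deriv Ψ = ψ from funext fun x => (hd x).deriv]
  obtain ⟨R, hR⟩ := hs.isCompact.isBounded.subset_closedBall (0 : ℝ)
  have hsupp : HasCompactSupport fun x => Ψ x - Ψ (x - h) := by
    refine HasCompactSupport.intro (isCompact_closedBall (0 : ℝ) (R + |h|)) fun x hx => ?_
    have e : Ψ x - Ψ (x - h) = ∫ y in (x - h)..x, ψ y :=
      intervalIntegral.integral_interval_sub_left (hψ.continuous.intervalIntegrable _ _)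
        (hψ.continuous.intervalIntegrable _ _)
    rw [e]
    refine (intervalIntegral.integral_congr (g := fun _ => 0) fun y hy => ?_).trans (by simp)
    by_contra hne
    have hy' : y ∈ Metric.closedBall (0 : ℝ) R := hR (subset_closure hne)
    have hy2 : |y - x| ≤ |h| := by
      have := abs_sub_left_of_mem_uIcc (by rwa [uIcc_comm] at hy : y ∈ uIcc x (x - h))
      simpa using this
    simp only [Metric.mem_closedBall, dist_zero_right, Real.norm_eq_abs, not_le] at hx hy'
    have := abs_sub_abs_le_abs_sub x y
    rw [abs_sub_comm] at this
    linarith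
  refine ⟨⟨fun x => Ψ x - Ψ (x - h), hΨs.sub (hΨs.comp (contDiff_id.sub contDiff_const)), hsupp,
    by simp⟩, fun x => ?_⟩
  exact ((hd x).sub ((hd (x - h)).comp_sub_const x h)).deriv

/-- A continuous function with vanishing distributional derivative is constant: testing against
`ψ - ψ(· - h)` shows that it is `h`-periodic for every `h`. -/
lemma eq_of_lineDeriv_ofFun_eq_zero {D : ℝ → ℝ} (hD : Continuous D)
    (h0 : ∂_{(1 : ℝ)} (ofFun D) = 0) (x y : ℝ) : D x = D y := by
  suffices H : ∀ h : ℝ, D = fun x => D (x + h) by simpa using congrFun (H (y - x)) x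
  intro h
  have hDh : Continuous fun x => D (x + h) := hD.comp (continuous_id.add continuous_const)
  refine (Continuous.ae_eq_iff_eq volume hD hDh).1 ?_
  refine ae_eq_of_integral_contDiff_smul_eq hD.locallyIntegrable hDh.locallyIntegrable
    fun ψ hψ hs => ?_
  obtain ⟨φ, hφ⟩ := exists_testFunction_deriv_eq_sub_translate hψ hs h
  have h1 : (∂_{(1 : ℝ)} (ofFun D)) φ = 0 := by rw [h0]; rfl
  rw [lineDeriv_ofFun_apply hD, neg_eq_zero] at h1
  simp_rw [hφ, sub_mul] at h1
  have hs2 : HasCompactSupport fun x => ψ (x - h) := by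
    simpa [sub_eq_add_neg] using! hs.comp_homeomorph (Homeomorph.addRight (-h))
  rw [integral_sub] at h1
  · simp only [smul_eq_mul]
    rw [sub_eq_zero.1 h1, ← integral_add_right_eq_self (fun x => ψ (x - h) * D x) h]
    simp
  · exact (hψ.continuous.mul hD).integrable_of_hasCompactSupport hs.mul_right
  · exact ((hψ.continuous.comp (continuous_id.sub continuous_const)).mul
      hD).integrable_of_hasCompactSupport hs2.mul_right

/-! ### Primitives and the Alexiewicz norm -/

lemma IsPrimitiveFun.sub {F G : ℝ → ℝ} (hF : IsPrimitiveFun F) (hG : IsPrimitiveFun G) :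
    IsPrimitiveFun fun x => F x - G x where
  continuous := hF.continuous.sub hG.continuous
  tendsto_atBot := by simpa using hF.tendsto_atBot.sub hG.tendsto_atBot
  exists_tendsto_atTop := by
    obtain ⟨L, hL⟩ := hF.exists_tendsto_atTop
    obtain ⟨M, hM⟩ := hG.exists_tendsto_atTop
    exact ⟨L - M, hL.sub hM⟩

/-- Subtracting from `F` a Lipschitz ramp that climbs from `0` to `F(∞)` leaves a continuous
function that vanishes at both ends. -/
lemma IsPrimitiveFun.exists_lipschitz_ramp {F : ℝ → ℝ} (hF : IsPrimitiveFun F) :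
    ∃ s : ℝ → ℝ, UniformContinuous s ∧ (∃ C, ∀ x, |s x| ≤ C) ∧
      Tendsto (fun x => F x - s x) (cocompact ℝ) (𝓝 0) := by
  obtain ⟨L, hL⟩ := hF.exists_tendsto_atTop
  refine ⟨fun x => L * max 0 (min x 1), ?_, ⟨|L|, fun x => ?_⟩, ?_⟩
  · have h1 : LipschitzWith 1 fun x : ℝ => max 0 (min x 1) :=
      (LipschitzWith.id.min_const 1).const_max 0
    exact (uniformContinuous_const_smul L).comp h1.uniformContinuous
  · rw [abs_mul]
    refine mul_le_of_le_one_right (abs_nonneg _) ?_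
    rw [abs_of_nonneg (le_max_left _ _)]
    exact max_le zero_le_one (min_le_right _ _)
  · rw [cocompact_eq_atBot_atTop, tendsto_sup]
    constructor
    · refine (hF.tendsto_atBot).congr' ?_
      filter_upwards [eventually_le_atBot 0] with x hx
      rw [max_eq_left ((min_le_left _ _).trans hx)]; simp
    · have := hL.sub_const L
      rw [sub_self] at this
      refine this.congr' ?_
      filter_upwards [eventually_ge_atTop 1] with x hx
      rw [min_eq_right hx, max_eq_right zero_le_one, mul_one]

lemma IsPrimitiveFun.uniformContinuous {F : ℝ → ℝ} (hF : IsPrimitiveFun F) :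
    UniformContinuous F := by
  obtain ⟨s, hs, -, h0⟩ := hF.exists_lipschitz_ramp
  have := ((hF.continuous.sub hs.continuous).uniformContinuous_of_tendsto_cocompact h0).add hs
  simpa using! this

lemma IsPrimitiveFun.exists_bound {F : ℝ → ℝ} (hF : IsPrimitiveFun F) :
    ∃ B, ∀ x, |F x| ≤ B := by
  obtain ⟨s, hs, ⟨C, hC⟩, h0⟩ := hF.exists_lipschitz_ramp
  let G : ZeroAtInftyContinuousMap ℝ ℝ :=
    ⟨⟨fun x => F x - s x, hF.continuous.sub hs.continuous⟩, h0⟩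
  obtain ⟨K, hK⟩ := G.isBounded_range.exists_norm_le
  refine ⟨K + C, fun x => ?_⟩
  have h1 : |F x - s x| ≤ K := hK (G x) ⟨x, rfl⟩
  calc |F x| = |(F x - s x) + s x| := by ring_nf
    _ ≤ _ := (abs_add_le _ _).trans (add_le_add h1 (hC x))

lemma lineDeriv_ofFun_sub {F G : ℝ → ℝ} (hF : Continuous F) (hG : Continuous G) :
    ∂_{(1 : ℝ)} (ofFun fun x => F x - G x) = ∂_{(1 : ℝ)} (ofFun F) - ∂_{(1 : ℝ)} (ofFun G) := by
  rw [ofFun_sub hF hG]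
  exact map_sub (Distribution.lineDerivCLM (1 : ℝ)) _ _

lemma HasPrimitive.sub {f g : Distr} {F G : ℝ → ℝ} (hF : HasPrimitive f F)
    (hG : HasPrimitive g G) : HasPrimitive (f - g) fun x => F x - G x :=
  ⟨hF.1.sub hG.1, by rw [lineDeriv_ofFun_sub hF.1.continuous hG.1.continuous, hF.2, hG.2]⟩

lemma HasPrimitive.unique {f : Distr} {F G : ℝ → ℝ} (hF : HasPrimitive f F)
    (hG : HasPrimitive f G) : F = G := by
  have h := hF.sub hG
  rw [sub_self] at h
  have hc := eq_of_lineDeriv_ofFun_eq_zero h.1.continuous h.2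
  ext x
  have h2 : Tendsto (fun _ : ℝ => F x - G x) atBot (𝓝 0) :=
    h.1.tendsto_atBot.congr fun y => hc y x
  exact sub_eq_zero.1 (tendsto_nhds_unique tendsto_const_nhds h2)

lemma HasPrimitive.primitive_eq {f : Distr} {F : ℝ → ℝ} (hF : HasPrimitive f F) :
    primitive f = F := by
  have h : f ∈ Ac := ⟨F, hF⟩
  rw [primitive, dif_pos h]
  exact HasPrimitive.unique h.choose_spec hF

lemma HasPrimitive.abs_sub_le_alexNorm {f : Distr} {F : ℝ → ℝ} (hF : HasPrimitive f F)
    {x y : ℝ} (hxy : x < y) : |F y - F x| ≤ alexNorm f := by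
  obtain ⟨B, hB⟩ := hF.1.exists_bound
  rw [alexNorm, hF.primitive_eq]
  refine le_csSup ⟨B + B, ?_⟩ ⟨x, y, hxy, rfl⟩
  rintro r ⟨x, y, -, rfl⟩
  exact (abs_sub _ _).trans (add_le_add (hB y) (hB x))

lemma HasPrimitive.alexNorm_le {f : Distr} {F : ℝ → ℝ} (hF : HasPrimitive f F) {C : ℝ}
    (hC : ∀ x, |F x| ≤ C) : alexNorm f ≤ 2 * C := by
  rw [alexNorm, hF.primitive_eq]
  refine csSup_le ⟨_, 0, 1, zero_lt_one, rfl⟩ ?_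
  rintro r ⟨x, y, -, rfl⟩
  linarith [abs_sub (F y) (F x), hC x, hC y]

lemma HasPrimitive.alexNorm_nonneg {f : Distr} {F : ℝ → ℝ} (hF : HasPrimitive f F) :
    0 ≤ alexNorm f :=
  (abs_nonneg _).trans (hF.abs_sub_le_alexNorm zero_lt_one)

/-- If a continuous function `g` lies in `𝓐_c` then its continuous primitive integral over a
bounded interval is its Riemann integral. -/
lemma HasPrimitive.sub_eq_integral {g P : ℝ → ℝ} (hg : Continuous g)
    (hP : HasPrimitive (ofFun g) P) (x y : ℝ) : P y - P x = ∫ s in x..y, g s := by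
  set G : ℝ → ℝ := fun z => ∫ s in (0 : ℝ)..z, g s
  have hd : ∀ z, HasDerivAt G (g z) z := fun z =>
    intervalIntegral.integral_hasDerivAt_right (hg.intervalIntegrable _ _)
      (hg.stronglyMeasurableAtFilter _ _) hg.continuousAt
  have hGc : Continuous G := continuous_iff_continuousAt.2 fun z => (hd z).continuousAt
  have h0 : ∂_{(1 : ℝ)} (ofFun fun z => P z - G z) = 0 := by
    rw [lineDeriv_ofFun_sub hP.1.continuous hGc, hP.2, lineDeriv_ofFun_of_hasDerivAt hg hd,
      sub_self]
  have h1 : P x - G x = P y - G y :=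
    eq_of_lineDeriv_ofFun_eq_zero (hP.1.continuous.sub hGc) h0 x y
  have h2 : G y - G x = ∫ s in x..y, g s :=
    intervalIntegral.integral_interval_sub_left (hg.intervalIntegrable _ _)
      (hg.intervalIntegrable _ _)
  linarith

end AlexHeat

/-! ### Gaussian moments of a bounded continuous function -/

noncomputable section

namespace AlexHeat

/-- The convolution of `F` with `z ↦ z ^ k * exp (-a z²)`, evaluated at `x`. All derivatives of
the convolution of `F` with the heat kernel are combinations of these functions, `a = 1 / (4 t)`. -/
def gaussMoment (F : ℝ → ℝ) (k : ℕ) (x a : ℝ) : ℝ :=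
  ∫ ξ, F ξ * ((x - ξ) ^ k * Real.exp (-(a * (x - ξ) ^ 2)))

/-- The constant in the majorant of `abs_pow_mul_exp_le`. -/
def gaussConst (k : ℕ) (b : ℝ) : ℝ := k.factorial * Real.exp (1 / (2 * b) + b / 2)

/-- A Gaussian majorant, uniform in `z` within distance `1` of `z₀` and in `a ≥ b`. -/
lemma abs_pow_mul_exp_le (k : ℕ) {a b z z₀ : ℝ} (hb : 0 < b) (hab : b ≤ a)
    (hz : |z - z₀| ≤ 1) :
    |z ^ k * Real.exp (-(a * z ^ 2))| ≤ gaussConst k b * Real.exp (-(b / 4) * z₀ ^ 2) := by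
  rw [abs_mul, Real.abs_exp, abs_pow]
  have h1 : |z| ^ k ≤ k.factorial * Real.exp |z| := by
    have := Real.pow_div_factorial_le_exp |z| (abs_nonneg z) k
    rwa [div_le_iff₀ (by positivity), mul_comm] at this
  have h2 : |z| ≤ b * z ^ 2 / 2 + 1 / (2 * b) := by
    have h : 0 ≤ (b * |z| - 1) ^ 2 / (2 * b) := by positivity
    have e : (b * |z| - 1) ^ 2 / (2 * b) = b * z ^ 2 / 2 + 1 / (2 * b) - |z| := by
      rw [← sq_abs z]; field_simp; ring
    linarith
  have h3 : z₀ ^ 2 ≤ 2 * z ^ 2 + 2 := by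
    have := abs_le.1 hz
    nlinarith [sq_nonneg (z + (z - z₀))]
  have h4 : b * z ^ 2 ≤ a * z ^ 2 := by gcongr
  calc |z| ^ k * Real.exp (-(a * z ^ 2))
      ≤ (k.factorial * Real.exp |z|) * Real.exp (-(a * z ^ 2)) := by gcongr
    _ = k.factorial * Real.exp (|z| - a * z ^ 2) := by
        rw [mul_assoc, ← Real.exp_add]; ring_nf
    _ ≤ k.factorial * Real.exp (1 / (2 * b) + b / 2 + -(b / 4) * z₀ ^ 2) := by
        gcongr; nlinarith
    _ = _ := by rw [gaussConst, Real.exp_add]; ring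

lemma integrable_exp_translate {b : ℝ} (hb : 0 < b) (x : ℝ) :
    Integrable fun ξ : ℝ => Real.exp (-(b / 4) * (x - ξ) ^ 2) :=
  (integrable_exp_neg_mul_sq (by positivity : 0 < b / 4)).comp_sub_left x

section

variable {F : ℝ → ℝ} {B : ℝ}

lemma norm_mul_gauss_le (hB : ∀ x, |F x| ≤ B) (k : ℕ) {a b x x₀ : ℝ} (hb : 0 < b) (hab : b ≤ a)
    (hx : |x - x₀| ≤ 1) (ξ : ℝ) :
    ‖F ξ * ((x - ξ) ^ k * Real.exp (-(a * (x - ξ) ^ 2)))‖ ≤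
      B * gaussConst k b * Real.exp (-(b / 4) * (x₀ - ξ) ^ 2) := by
  rw [norm_mul, mul_assoc]
  have h0 : 0 ≤ B := (abs_nonneg _).trans (hB 0)
  exact mul_le_mul (hB ξ) (abs_pow_mul_exp_le k hb hab (by simpa using hx)) (norm_nonneg _) h0

lemma continuous_gauss_integrand (hF : Continuous F) (k : ℕ) (x a : ℝ) :
    Continuous fun ξ => F ξ * ((x - ξ) ^ k * Real.exp (-(a * (x - ξ) ^ 2))) := by
  fun_prop

lemma integrable_gauss_integrand (hF : Continuous F) (hB : ∀ x, |F x| ≤ B) (k : ℕ) (x : ℝ) {a : ℝ}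
    (ha : 0 < a) :
    Integrable fun ξ => F ξ * ((x - ξ) ^ k * Real.exp (-(a * (x - ξ) ^ 2))) :=
  ((integrable_exp_translate ha x).const_mul (B * gaussConst k a)).mono'
    (continuous_gauss_integrand hF k x a).aestronglyMeasurable
    (Eventually.of_forall fun ξ => norm_mul_gauss_le hB k ha le_rfl (by simp) ξ)

lemma continuousAt_gaussMoment (hF : Continuous F) (hB : ∀ x, |F x| ≤ B) (k : ℕ) {x a : ℝ}
    (ha : 0 < a) : ContinuousAt (fun p : ℝ × ℝ => gaussMoment F k p.1 p.2) (x, a) := by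
  have ha2 : 0 < a / 2 := by positivity
  refine continuousAt_of_dominated
    (bound := fun ξ => B * gaussConst k (a / 2) * Real.exp (-(a / 2 / 4) * (x - ξ) ^ 2))
    (Eventually.of_forall fun p => (continuous_gauss_integrand hF k p.1 p.2).aestronglyMeasurable)
    ?_ ((integrable_exp_translate ha2 x).const_mul _) (Eventually.of_forall fun ξ => by fun_prop)
  have h1 : ∀ᶠ p : ℝ × ℝ in 𝓝 (x, a), |p.1 - x| ≤ 1 := by
    have : Tendsto (fun p : ℝ × ℝ => |p.1 - x|) (𝓝 (x, a)) (𝓝 |x - x|) :=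
      Continuous.tendsto (f := fun p : ℝ × ℝ => |p.1 - x|) (by fun_prop) (x, a)
    exact this.eventually_le_const (by simp)
  have h2 : ∀ᶠ p : ℝ × ℝ in 𝓝 (x, a), a / 2 ≤ p.2 :=
    (continuous_snd.tendsto (x, a)).eventually_const_le (half_lt_self ha)
  filter_upwards [h1, h2] with p hp1 hp2
  exact Eventually.of_forall fun ξ => norm_mul_gauss_le hB k ha2 hp2 hp1 ξ

lemma hasDerivAt_gaussMoment_space (hF : Continuous F) (hB : ∀ x, |F x| ≤ B) (k : ℕ) {x a : ℝ}
    (ha : 0 < a) :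
    HasDerivAt (fun y => gaussMoment F k y a)
      (k * gaussMoment F (k - 1) x a - 2 * a * gaussMoment F (k + 1) x a) x := by
  have key := (hasDerivAt_integral_of_dominated_loc_of_deriv_le (μ := volume)
    (F := fun y ξ => F ξ * ((y - ξ) ^ k * Real.exp (-(a * (y - ξ) ^ 2))))
    (F' := fun y ξ => k * (F ξ * ((y - ξ) ^ (k - 1) * Real.exp (-(a * (y - ξ) ^ 2))))
      - 2 * a * (F ξ * ((y - ξ) ^ (k + 1) * Real.exp (-(a * (y - ξ) ^ 2)))))
    (x₀ := x) (s := Metric.ball x 1)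
    (bound := fun ξ => k * (B * gaussConst (k - 1) a * Real.exp (-(a / 4) * (x - ξ) ^ 2))
      + 2 * a * (B * gaussConst (k + 1) a * Real.exp (-(a / 4) * (x - ξ) ^ 2)))
    (Metric.ball_mem_nhds x one_pos)
    (Eventually.of_forall fun y => (continuous_gauss_integrand hF k y a).aestronglyMeasurable)
    (integrable_gauss_integrand hF hB k x ha)
    (Continuous.aestronglyMeasurable (by fun_prop))
    (Eventually.of_forall fun ξ y hy => ?_)
    ((((integrable_exp_translate ha x).const_mul _).const_mul _).add
      (((integrable_exp_translate ha x).const_mul _).const_mul _))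
    (Eventually.of_forall fun ξ y hy => ?_)).2
  · rw [integral_sub, integral_const_mul, integral_const_mul] at key
    · exact key
    · exact (integrable_gauss_integrand hF hB _ x ha).const_mul _
    · exact (integrable_gauss_integrand hF hB _ x ha).const_mul _
  · have hy' : |y - x| ≤ 1 := (mem_ball_iff_norm.1 hy).le
    refine (norm_sub_le _ _).trans (add_le_add ?_ ?_)
    · rw [norm_mul, Real.norm_natCast]
      gcongr
      exact norm_mul_gauss_le hB _ ha le_rfl hy' ξ
    · rw [norm_mul, Real.norm_of_nonneg (by positivity : 0 ≤ 2 * a)]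
      gcongr
      exact norm_mul_gauss_le hB _ ha le_rfl hy' ξ
  · have h1 : HasDerivAt (fun y => y - ξ) 1 y := (hasDerivAt_id y).sub_const ξ
    have h2 := ((h1.fun_pow k).mul ((((h1.fun_pow 2).const_mul a).neg).exp)).const_mul (F ξ)
    refine h2.congr_deriv ?_
    simp only [Pi.neg_apply, Nat.cast_ofNat]
    ring

lemma hasDerivAt_gaussMoment_rate (hF : Continuous F) (hB : ∀ x, |F x| ≤ B) (k : ℕ) {x a : ℝ}
    (ha : 0 < a) :
    HasDerivAt (fun b => gaussMoment F k x b) (-gaussMoment F (k + 2) x a) a := by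
  have ha2 : 0 < a / 2 := by positivity
  have key := (hasDerivAt_integral_of_dominated_loc_of_deriv_le (μ := volume)
    (F := fun b ξ => F ξ * ((x - ξ) ^ k * Real.exp (-(b * (x - ξ) ^ 2))))
    (F' := fun b ξ => -(F ξ * ((x - ξ) ^ (k + 2) * Real.exp (-(b * (x - ξ) ^ 2)))))
    (x₀ := a) (s := Ioi (a / 2))
    (bound := fun ξ => B * gaussConst (k + 2) (a / 2) * Real.exp (-(a / 2 / 4) * (x - ξ) ^ 2))
    (Ioi_mem_nhds (half_lt_self ha))
    (Eventually.of_forall fun b => (continuous_gauss_integrand hF k x b).aestronglyMeasurable)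
    (integrable_gauss_integrand hF hB k x ha)
    (Continuous.aestronglyMeasurable (by fun_prop))
    (Eventually.of_forall fun ξ b hb => ?_)
    ((integrable_exp_translate ha2 x).const_mul _)
    (Eventually.of_forall fun ξ b hb => ?_)).2
  · rw [integral_neg] at key
    exact key
  · rw [norm_neg]
    exact norm_mul_gauss_le hB _ ha2 (le_of_lt hb) (by simp) ξ
  · have h2 := ((((hasDerivAt_id b).mul_const ((x - ξ) ^ 2)).neg.exp).const_mul
      ((x - ξ) ^ k)).const_mul (F ξ)
    refine h2.congr_deriv ?_
    simp only [Pi.neg_apply, id]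
    ring

lemma contDiff_gaussMoment (hF : Continuous F) (hB : ∀ x, |F x| ≤ B) {a : ℝ} (ha : 0 < a)
    (n k : ℕ) : ContDiff ℝ n fun x => gaussMoment F k x a := by
  have hd := fun k x => hasDerivAt_gaussMoment_space hF hB k (x := x) ha
  induction n generalizing k with
  | zero =>
    exact contDiff_zero.2 (continuous_iff_continuousAt.2 fun x => (hd k x).continuousAt)
  | succ n ih =>
    rw [Nat.cast_succ, contDiff_succ_iff_deriv]
    refine ⟨fun x => (hd k x).differentiableAt, by simp, ?_⟩
    rw [show (deriv fun x => gaussMoment F k x a) = _ from funext fun x => (hd k x).deriv]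
    exact (contDiff_const.mul (ih (k - 1))).sub (contDiff_const.mul (ih (k + 1)))

lemma contDiffOn_gaussMoment (hF : Continuous F) (hB : ∀ x, |F x| ≤ B) (x : ℝ) (n k : ℕ) :
    ContDiffOn ℝ n (fun a => gaussMoment F k x a) (Ioi 0) := by
  have hd := fun k a (ha : a ∈ Ioi (0 : ℝ)) => hasDerivAt_gaussMoment_rate hF hB k (x := x) ha
  induction n generalizing k with
  | zero =>
    exact contDiffOn_zero.2 fun a ha => (hd k a ha).continuousAt.continuousWithinAt
  | succ n ih =>
    rw [Nat.cast_succ, contDiffOn_succ_iff_deriv_of_isOpen isOpen_Ioi]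
    refine ⟨fun a ha => (hd k a ha).differentiableAt.differentiableWithinAt, by simp, ?_⟩
    exact (ih (k + 2)).neg.congr fun a ha => (hd k a ha).deriv

end

end AlexHeat

end

/-! ### The Gauss-Weierstrass solution -/

noncomputable section

namespace AlexHeat

lemma sqrt_div_pi_mul_gaussMoment_one_zero (x : ℝ) {a : ℝ} (ha : 0 < a) :
    √(a / Real.pi) * gaussMoment (fun _ => 1) 0 x a = 1 := by
  have h : gaussMoment (fun _ => 1) 0 x a = √(Real.pi / a) := by
    rw [← integral_gaussian, ← integral_sub_left_eq_self (fun ξ => Real.exp (-a * ξ ^ 2)) volume x]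
    simp [gaussMoment]
  rw [h, ← Real.sqrt_mul (by positivity)]
  have := Real.pi_pos
  rw [show a / Real.pi * (Real.pi / a) = 1 by field_simp, Real.sqrt_one]

/-- The second moment of the normalised Gaussian, found by differentiating
`∫ exp (-a z²) = √(π / a)` with respect to `a`. -/
lemma sqrt_div_pi_mul_gaussMoment_one_two (x : ℝ) {a : ℝ} (ha : 0 < a) :
    √(a / Real.pi) * gaussMoment (fun _ => 1) 2 x a = 1 / (2 * a) := by
  have hpi := Real.pi_pos
  have h1 := hasDerivAt_gaussMoment_rate (F := fun _ => 1) (B := 1) continuous_const (by simp) 0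
    (x := x) ha
  have h2 : HasDerivAt (fun b : ℝ => √(b / Real.pi))
      (1 / Real.pi / (2 * √(a / Real.pi))) a :=
    ((hasDerivAt_id a).div_const Real.pi).sqrt (by simp only [id]; positivity)
  have h3 := h2.mul h1
  have h4 : HasDerivAt ((fun b : ℝ => √(b / Real.pi)) *
      fun b => gaussMoment (fun _ => 1) 0 x b) 0 a := by
    refine (hasDerivAt_const a (1 : ℝ)).congr_of_eventuallyEq ?_
    filter_upwards [Ioi_mem_nhds ha] with b hb
    exact sqrt_div_pi_mul_gaussMoment_one_zero x hb
  have h5 := h3.unique h4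
  have h6 := sqrt_div_pi_mul_gaussMoment_one_zero x ha
  have hs : 0 < √(a / Real.pi) := Real.sqrt_pos.2 (by positivity)
  have hsq : √(a / Real.pi) ^ 2 = a / Real.pi := Real.sq_sqrt (by positivity)
  have h7 : √(a / Real.pi) * gaussMoment (fun _ => 1) 2 x a =
      1 / Real.pi / (2 * √(a / Real.pi) ^ 2) *
        (√(a / Real.pi) * gaussMoment (fun _ => 1) 0 x a) := by
    simp only [zero_add] at h5
    rw [show 1 / Real.pi / (2 * √(a / Real.pi) ^ 2) *
        (√(a / Real.pi) * gaussMoment (fun _ => 1) 0 x a) =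
        1 / Real.pi / (2 * √(a / Real.pi)) * gaussMoment (fun _ => 1) 0 x a by
      field_simp]
    linarith
  rw [h7, h6, hsq]
  field_simp

section

variable {F : ℝ → ℝ} {B : ℝ}

lemma tendsto_gaussMoment_zero (hF : Continuous F) (hB : ∀ x, |F x| ≤ B) {a L : ℝ} (ha : 0 < a)
    {l : Filter ℝ} [l.IsCountablyGenerated] (hl : ∀ z, Tendsto (fun x => x - z) l l)
    (hL : Tendsto F l (𝓝 L)) :
    Tendsto (fun x => gaussMoment F 0 x a) l (𝓝 (∫ z, L * Real.exp (-a * z ^ 2))) := by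
  have e : (fun x => gaussMoment F 0 x a) = fun x => ∫ z, F (x - z) * Real.exp (-a * z ^ 2) := by
    ext x
    rw [← integral_sub_left_eq_self _ volume x]
    simp [gaussMoment]
  rw [e]
  refine tendsto_integral_filter_of_dominated_convergence
    (fun z => B * Real.exp (-a * z ^ 2))
    (Eventually.of_forall fun x => Continuous.aestronglyMeasurable (by fun_prop))
    (Eventually.of_forall fun x => Eventually.of_forall fun z => ?_)
    ((integrable_exp_neg_mul_sq ha).const_mul B)
    (Eventually.of_forall fun z => (hL.comp (hl z)).mul_const _)
  rw [norm_mul, Real.norm_of_nonneg (Real.exp_pos _).le]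
  gcongr
  exact hB _

/-- A modulus of continuity of the form `|F ξ - F x| ≤ ε + C (x - ξ)²` passes to the distance
between `F` and its Gaussian means. -/
lemma abs_gaussMean_sub_le (hF : Continuous F) (hB : ∀ x, |F x| ≤ B) {a ε C : ℝ} (ha : 0 < a)
    (hmod : ∀ x ξ, |F ξ - F x| ≤ ε + C * (x - ξ) ^ 2) (x : ℝ) :
    |√(a / Real.pi) * gaussMoment F 0 x a - F x| ≤ ε + C * (1 / (2 * a)) := by
  have i1 : ∀ k, Integrable fun ξ => (1 : ℝ) * ((x - ξ) ^ k * Real.exp (-(a * (x - ξ) ^ 2))) :=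
    fun k => integrable_gauss_integrand (F := fun _ => 1) (B := 1) continuous_const (by simp) k x ha
  have e1 : gaussMoment F 0 x a - F x * gaussMoment (fun _ => 1) 0 x a =
      ∫ ξ, (F ξ - F x) * Real.exp (-(a * (x - ξ) ^ 2)) := by
    rw [gaussMoment, gaussMoment, ← integral_const_mul, ← integral_sub]
    · congr 1; ext ξ; ring
    · exact integrable_gauss_integrand hF hB 0 x ha
    · exact (i1 0).const_mul _
  have e2 : |gaussMoment F 0 x a - F x * gaussMoment (fun _ => 1) 0 x a| ≤
      ε * gaussMoment (fun _ => 1) 0 x a + C * gaussMoment (fun _ => 1) 2 x a := by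
    rw [e1, gaussMoment, gaussMoment, ← integral_const_mul, ← integral_const_mul, ← integral_add
      ((i1 0).const_mul _) ((i1 2).const_mul _), ← Real.norm_eq_abs]
    refine norm_integral_le_of_norm_le (((i1 0).const_mul _).add ((i1 2).const_mul _))
      (Eventually.of_forall fun ξ => ?_)
    rw [norm_mul, Real.norm_of_nonneg (Real.exp_pos _).le, Real.norm_eq_abs]
    calc |F ξ - F x| * Real.exp (-(a * (x - ξ) ^ 2))
        ≤ (ε + C * (x - ξ) ^ 2) * Real.exp (-(a * (x - ξ) ^ 2)) := by
          gcongr; exact hmod x ξ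
      _ = _ := by ring
  have hs : 0 ≤ √(a / Real.pi) := Real.sqrt_nonneg _
  have m0 := sqrt_div_pi_mul_gaussMoment_one_zero x ha
  have m2 := sqrt_div_pi_mul_gaussMoment_one_two x ha
  calc |√(a / Real.pi) * gaussMoment F 0 x a - F x|
      = √(a / Real.pi) * |gaussMoment F 0 x a - F x * gaussMoment (fun _ => 1) 0 x a| := by
        rw [← abs_of_nonneg hs, ← abs_mul, abs_of_nonneg hs]
        congr 1
        linear_combination F x * m0
    _ ≤ √(a / Real.pi) * (ε * gaussMoment (fun _ => 1) 0 x a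
          + C * gaussMoment (fun _ => 1) 2 x a) := by gcongr
    _ = _ := by linear_combination ε * m0 + C * m2

lemma abs_gaussMean_le (hF : Continuous F) (hB : ∀ x, |F x| ≤ B) {a : ℝ} (ha : 0 < a) (x : ℝ) :
    |√(a / Real.pi) * gaussMoment F 0 x a| ≤ 3 * B := by
  have h := abs_gaussMean_sub_le hF hB (ε := 2 * B) (C := 0) ha
    (fun x ξ => by linarith [abs_sub (F ξ) (F x), hB ξ, hB x]) x
  have h2 := abs_sub_abs_le_abs_sub (√(a / Real.pi) * gaussMoment F 0 x a) (F x)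
  linarith [hB x]

lemma exists_quadratic_modulus (hF : UniformContinuous F) (hB : ∀ x, |F x| ≤ B) {ε : ℝ}
    (hε : 0 < ε) : ∃ C, ∀ x ξ, |F ξ - F x| ≤ ε + C * (x - ξ) ^ 2 := by
  obtain ⟨δ, hδ, h⟩ := Metric.uniformContinuous_iff.1 hF ε hε
  have hB0 : 0 ≤ B := (abs_nonneg _).trans (hB 0)
  refine ⟨2 * B / δ ^ 2, fun x ξ => ?_⟩
  rcases lt_or_ge (dist ξ x) δ with hlt | hge
  · have h1 : |F ξ - F x| < ε := h hlt
    have : 0 ≤ 2 * B / δ ^ 2 * (x - ξ) ^ 2 := by positivity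
    linarith
  · have h1 : δ ^ 2 ≤ (x - ξ) ^ 2 := by
      rw [Real.dist_eq, abs_sub_comm] at hge
      exact sq_le_sq.2 (by rwa [abs_of_pos hδ])
    have h2 : 2 * B ≤ 2 * B / δ ^ 2 * (x - ξ) ^ 2 := by
      rw [div_mul_eq_mul_div, le_div_iff₀ (by positivity)]
      gcongr
    linarith [abs_sub (F ξ) (F x), hB ξ, hB x]

end

lemma heatKernel_eq {t : ℝ} (ht : 0 < t) (z : ℝ) :
    heatKernel t z = √((4 * t)⁻¹ / Real.pi) * Real.exp (-((4 * t)⁻¹ * z ^ 2)) := by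
  have hpi := Real.pi_pos
  rw [heatKernel, abs_of_pos ht, div_eq_mul_inv, ← Real.sqrt_inv, mul_comm]
  congr 2
  · field_simp
  · field_simp

lemma heatConv_eq {f : Distr} {F : ℝ → ℝ} (hF : HasPrimitive f F) (x : ℝ) {t : ℝ} (ht : 0 < t) :
    heatConv f x t =
      -(2 * (4 * t)⁻¹ * √((4 * t)⁻¹ / Real.pi)) * gaussMoment F 1 x (4 * t)⁻¹ := by
  set a := (4 * t)⁻¹ with ha_def
  have ha : 0 < a := by positivity
  have hker : (fun ξ => heatKernel t (x - ξ)) =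
      fun ξ => √(a / Real.pi) * Real.exp (-(a * (x - ξ) ^ 2)) :=
    funext fun ξ => heatKernel_eq ht _
  have hlim : Tendsto (fun ξ => √(a / Real.pi) * Real.exp (-(a * (x - ξ) ^ 2))) atTop (𝓝 0) := by
    rw [← mul_zero √(a / Real.pi)]
    refine Tendsto.const_mul _ (Real.tendsto_exp_neg_atTop_nhds_zero.comp ?_)
    refine Tendsto.const_mul_atTop ha ?_
    have : (fun ξ : ℝ => (x - ξ) ^ 2) = fun ξ => (ξ - x) ^ 2 := by ext ξ; ring
    rw [this]
    exact (tendsto_pow_atTop two_ne_zero).comp (tendsto_atTop_add_const_right _ (-x) tendsto_id)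
  rw [heatConv, integralMul, hF.primitive_eq, hker, hlim.limUnder_eq, mul_zero, zero_sub,
    gaussMoment, ← integral_const_mul, ← integral_neg]
  congr 1
  ext ξ
  have h1 : HasDerivAt (fun ξ => x - ξ) (-1) ξ := (hasDerivAt_id ξ).const_sub x
  have h2 := (((h1.fun_pow 2).const_mul a).fun_neg.exp).const_mul √(a / Real.pi)
  rw [h2.deriv]
  simp only [Nat.cast_ofNat]
  ring

/-- The convolution of the primitive of `f` with the heat kernel is a primitive of
`f ∗ Θ_t`. -/
lemma hasPrimitive_heatConv {f : Distr} {F : ℝ → ℝ} (hF : HasPrimitive f F) {t : ℝ} (ht : 0 < t) :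
    HasPrimitive (ofFun fun x => heatConv f x t)
      fun x => √((4 * t)⁻¹ / Real.pi) * gaussMoment F 0 x (4 * t)⁻¹ := by
  obtain ⟨B, hB⟩ := hF.1.exists_bound
  have hFc := hF.1.continuous
  have e : (fun x => heatConv f x t) = fun x =>
      -(2 * (4 * t)⁻¹ * √((4 * t)⁻¹ / Real.pi)) * gaussMoment F 1 x (4 * t)⁻¹ :=
    funext fun x => heatConv_eq hF x ht
  rw [e]
  have ha : 0 < (4 * t)⁻¹ := by positivity
  generalize (4 * t)⁻¹ = a at ha ⊢
  have hd : ∀ x, HasDerivAt (fun x => √(a / Real.pi) * gaussMoment F 0 x a)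
      (-(2 * a * √(a / Real.pi)) * gaussMoment F 1 x a) x := fun x => by
    refine ((hasDerivAt_gaussMoment_space hFc hB 0 ha).const_mul _).congr_deriv ?_
    simp only [Nat.cast_zero, zero_mul, zero_sub, zero_add]
    ring
  refine ⟨⟨continuous_iff_continuousAt.2 fun x => (hd x).continuousAt, ?_, ?_⟩,
    lineDeriv_ofFun_of_hasDerivAt
      (continuous_const.mul (contDiff_gaussMoment hFc hB ha 0 1).continuous) hd⟩
  · have := (tendsto_gaussMoment_zero hFc hB ha
      (fun z => tendsto_atBot_add_const_right _ (-z) tendsto_id) hF.1.tendsto_atBot).const_mul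
        √(a / Real.pi)
    simpa using this
  · obtain ⟨L, hL⟩ := hF.1.exists_tendsto_atTop
    exact ⟨_, (tendsto_gaussMoment_zero hFc hB ha
      (fun z => tendsto_atTop_add_const_right _ (-z) tendsto_id) hL).const_mul √(a / Real.pi)⟩

lemma isClassicalSolution_heatConv {f : Distr} {F : ℝ → ℝ} (hF : HasPrimitive f F) :
    IsClassicalSolution fun x t => heatConv f x t := by
  obtain ⟨B, hB⟩ := hF.1.exists_bound
  have hFc := hF.1.continuous
  have hpi := Real.pi_pos
  have e : ∀ t, 0 < t → (fun x => heatConv f x t) = fun x =>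
      -(2 * (4 * t)⁻¹ * √((4 * t)⁻¹ / Real.pi)) * gaussMoment F 1 x (4 * t)⁻¹ :=
    fun t ht => funext fun x => heatConv_eq hF x ht
  have hpos : ∀ {t : ℝ}, 0 < t → 0 < (4 * t)⁻¹ := fun ht => by positivity
  refine ⟨?_, fun t ht => ?_, fun x => ?_, fun x t ht => ?_⟩
  · refine ContinuousOn.congr (f := fun p : ℝ × ℝ =>
      -(2 * (4 * p.2)⁻¹ * √((4 * p.2)⁻¹ / Real.pi)) * gaussMoment F 1 p.1 (4 * p.2)⁻¹) ?_
      fun p hp => heatConv_eq hF p.1 hp.2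
    rintro ⟨x, t⟩ ⟨-, ht⟩
    have ht : 0 < t := ht
    have h4 : (4 * t) ≠ 0 := by positivity
    have hinv : ContinuousAt (fun p : ℝ × ℝ => (4 * p.2)⁻¹) (x, t) :=
      ContinuousAt.inv₀ (by fun_prop) h4
    have hm : ContinuousAt (fun p : ℝ × ℝ => gaussMoment F 1 p.1 (4 * p.2)⁻¹) (x, t) :=
      ContinuousAt.comp_of_eq (g := fun p : ℝ × ℝ => gaussMoment F 1 p.1 p.2)
        (f := fun p : ℝ × ℝ => (p.1, (4 * p.2)⁻¹))
        (continuousAt_gaussMoment hFc hB 1 (hpos ht)) (continuousAt_fst.prodMk hinv) rfl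
    exact (((continuousAt_const.mul hinv).mul (hinv.div_const _).sqrt).neg.mul
      hm).continuousWithinAt
  · rw [e t ht]
    exact contDiff_const.mul (contDiff_gaussMoment hFc hB (hpos ht) 2 1)
  · have h1 : ContDiffOn ℝ 1 (fun a => -(2 * a * √(a / Real.pi)) * gaussMoment F 1 x a)
        (Ioi 0) := by
      refine ContDiffOn.mul (ContDiffOn.neg (ContDiffOn.mul (by fun_prop) ?_))
        (contDiffOn_gaussMoment hFc hB x 1 1)
      exact ContDiffOn.sqrt (by fun_prop) fun a ha => (div_pos ha hpi).ne'
    have h2 : ContDiffOn ℝ 1 (fun t : ℝ => (4 * t)⁻¹) (Ioi 0) :=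
      ContDiffOn.inv (by fun_prop) fun t ht => (mul_pos four_pos ht).ne'
    exact (h1.comp h2 fun t ht => hpos ht).congr fun t ht => heatConv_eq hF x ht
  · set a := (4 * t)⁻¹ with ha_def
    have ha : 0 < a := hpos ht
    have hs : 0 < √(a / Real.pi) := Real.sqrt_pos.2 (by positivity)
    have hsq : √(a / Real.pi) ^ 2 = a / Real.pi := Real.sq_sqrt (by positivity)
    have hx1 : deriv (fun y => heatConv f y t) = fun y => -(2 * a * √(a / Real.pi)) *
        (gaussMoment F 0 y a - 2 * a * gaussMoment F 2 y a) := by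
      rw [e t ht, ← ha_def]
      ext y
      refine (((hasDerivAt_gaussMoment_space hFc hB 1 ha).const_mul _).congr_deriv ?_).deriv
      simp
    have hx2 : deriv (deriv (fun y => heatConv f y t)) x = -(2 * a * √(a / Real.pi)) *
        (-6 * a * gaussMoment F 1 x a + 4 * a ^ 2 * gaussMoment F 3 x a) := by
      rw [hx1]
      refine ((((hasDerivAt_gaussMoment_space hFc hB 0 ha).sub
        ((hasDerivAt_gaussMoment_space hFc hB 2 ha).const_mul (2 * a))).const_mul
          _).congr_deriv ?_).deriv
      norm_num
      left
      ring
    have hinv : HasDerivAt (fun s : ℝ => (4 * s)⁻¹) (-4 * a ^ 2) t := by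
      refine (((hasDerivAt_id t).const_mul 4).fun_inv (by simp only [id]; positivity)).congr_deriv ?_
      simp only [id, ha_def]
      field_simp
    have hrate : HasDerivAt (fun b => -(2 * b * √(b / Real.pi)) * gaussMoment F 1 x b)
        (-(3 * √(a / Real.pi)) * gaussMoment F 1 x a
          + 2 * a * √(a / Real.pi) * gaussMoment F 3 x a) a := by
      have h2 : HasDerivAt (fun b : ℝ => √(b / Real.pi))
          (1 / Real.pi / (2 * √(a / Real.pi))) a :=
        ((hasDerivAt_id a).div_const Real.pi).sqrt (by simp only [id]; positivity)
      refine (((((hasDerivAt_id a).const_mul 2).mul h2).neg).mul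
        (hasDerivAt_gaussMoment_rate hFc hB 1 (x := x) ha)).congr_deriv ?_
      have h3 : 2 * a * (1 / Real.pi / (2 * √(a / Real.pi))) = √(a / Real.pi) := by
        rw [div_div, mul_one_div, div_eq_iff (by positivity)]
        have : a = √(a / Real.pi) ^ 2 * Real.pi := by rw [hsq]; field_simp
        linear_combination 2 * this
      simp only [Pi.mul_apply, Pi.neg_apply, id]
      rw [mul_one, h3]
      ring
    have ht1 : HasDerivAt (fun s => heatConv f x s)
        ((-(3 * √(a / Real.pi)) * gaussMoment F 1 x a
          + 2 * a * √(a / Real.pi) * gaussMoment F 3 x a) * (-4 * a ^ 2)) t := by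
      refine (HasDerivAt.comp t hrate hinv).congr_of_eventuallyEq ?_
      filter_upwards [Ioi_mem_nhds ht] with s hs
      exact heatConv_eq hF x hs
    rw [ht1.deriv, hx2]
    ring

lemma isAlexSolution_heatConv {f : Distr} {F : ℝ → ℝ} (hF : HasPrimitive f F) :
    IsAlexSolution f fun x t => heatConv f x t := by
  obtain ⟨B, hB⟩ := hF.1.exists_bound
  have hFc := hF.1.continuous
  refine ⟨isClassicalSolution_heatConv hF, fun t ht => ⟨_, hasPrimitive_heatConv hF ht⟩,
    ⟨2 * (3 * B), fun t ht => (hasPrimitive_heatConv hF ht).alexNorm_le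
      fun x => abs_gaussMean_le hFc hB (by positivity) x⟩, ?_⟩
  rw [Metric.tendsto_nhds]
  intro ε hε
  obtain ⟨C, hC⟩ := exists_quadratic_modulus hF.1.uniformContinuous hB
    (by positivity : 0 < ε / 4)
  have hsmall : ∀ᶠ t : ℝ in 𝓝[>] 0, 4 * C * t < ε / 2 := by
    have : Tendsto (fun t : ℝ => 4 * C * t) (𝓝[>] 0) (𝓝 (4 * C * 0)) :=
      (Continuous.tendsto (by fun_prop) 0).mono_left nhdsWithin_le_nhds
    exact this.eventually_lt_const (by simpa using half_pos hε)
  filter_upwards [hsmall, self_mem_nhdsWithin] with t hCt ht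
  have ht : 0 < t := ht
  have hP := (hasPrimitive_heatConv hF ht).sub hF
  have hle := hP.alexNorm_le fun x =>
    abs_gaussMean_sub_le hFc hB (by positivity : 0 < (4 * t)⁻¹) hC x
  rw [Real.dist_eq, sub_zero, abs_of_nonneg hP.alexNorm_nonneg]
  have : C * (1 / (2 * (4 * t)⁻¹)) = 2 * C * t := by field_simp; norm_num
  rw [this] at hle
  linarith

end AlexHeat

end

/-! ### The maximum principle for space averages of classical solutions -/

noncomputable section

namespace AlexHeat

namespace IsClassicalSolution

variable {u v : ℝ → ℝ → ℝ}

lemma continuous_space (hu : IsClassicalSolution u) {t : ℝ} (ht : 0 < t) :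
    Continuous fun x => u x t :=
  (hu.contDiff_space t ht).continuous

lemma differentiable_space (hu : IsClassicalSolution u) {t : ℝ} (ht : 0 < t) :
    Differentiable ℝ fun x => u x t :=
  (hu.contDiff_space t ht).differentiable two_ne_zero

lemma differentiable_deriv_space (hu : IsClassicalSolution u) {t : ℝ} (ht : 0 < t) :
    Differentiable ℝ (deriv fun x => u x t) := by
  have h := hu.contDiff_space t ht
  rw [show (2 : WithTop ℕ∞) = 1 + 1 by norm_num, contDiff_succ_iff_deriv] at h
  exact h.2.2.differentiable one_ne_zero

lemma differentiableAt_time (hu : IsClassicalSolution u) (x : ℝ) {t : ℝ} (ht : 0 < t) :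
    DifferentiableAt ℝ (fun s => u x s) t :=
  ((hu.contDiffOn_time x).differentiableOn one_ne_zero).differentiableAt (Ioi_mem_nhds ht)

lemma zero : IsClassicalSolution fun _ _ => 0 where
  continuousOn := continuousOn_const
  contDiff_space _ _ := contDiff_const
  contDiffOn_time _ := contDiffOn_const
  heat_eq _ _ _ := by simp

lemma add (hu : IsClassicalSolution u) (hv : IsClassicalSolution v) :
    IsClassicalSolution fun x t => u x t + v x t where
  continuousOn := hu.continuousOn.add hv.continuousOn
  contDiff_space t ht := (hu.contDiff_space t ht).add (hv.contDiff_space t ht)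
  contDiffOn_time x := (hu.contDiffOn_time x).add (hv.contDiffOn_time x)
  heat_eq x t ht := by
    have h1 : (deriv fun y => u y t + v y t) =
        fun y => deriv (fun y => u y t) y + deriv (fun y => v y t) y :=
      funext fun y => deriv_fun_add (hu.differentiable_space ht y) (hv.differentiable_space ht y)
    rw [h1, deriv_fun_add (hu.differentiable_deriv_space ht x) (hv.differentiable_deriv_space ht x),
      deriv_fun_add (hu.differentiableAt_time x ht) (hv.differentiableAt_time x ht),
      hu.heat_eq x t ht, hv.heat_eq x t ht]

lemma const_mul (hu : IsClassicalSolution u) (c : ℝ) :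
    IsClassicalSolution fun x t => c * u x t where
  continuousOn := continuousOn_const.mul hu.continuousOn
  contDiff_space t ht := contDiff_const.mul (hu.contDiff_space t ht)
  contDiffOn_time x := contDiffOn_const.mul (hu.contDiffOn_time x)
  heat_eq x t ht := by
    have h1 : (deriv fun y => c * u y t) = fun y => c * deriv (fun y => u y t) y :=
      funext fun y => deriv_const_mul c (hu.differentiable_space ht y)
    rw [h1, deriv_const_mul c (hu.differentiable_deriv_space ht x),
      deriv_const_mul c (hu.differentiableAt_time x ht), hu.heat_eq x t ht]

lemma sub (hu : IsClassicalSolution u) (hv : IsClassicalSolution v) :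
    IsClassicalSolution fun x t => u x t - v x t := by
  simpa [sub_eq_add_neg] using hu.add (hv.const_mul (-1))

lemma translate (hu : IsClassicalSolution u) (c : ℝ) :
    IsClassicalSolution fun x t => u (x + c) t where
  continuousOn := by
    refine hu.continuousOn.comp (f := fun p : ℝ × ℝ => (p.1 + c, p.2)) (by fun_prop) ?_
    exact fun p hp => ⟨mem_univ _, hp.2⟩
  contDiff_space t ht := (hu.contDiff_space t ht).comp (contDiff_id.add contDiff_const)
  contDiffOn_time x := hu.contDiffOn_time (x + c)
  heat_eq x t ht := by
    have h1 : (deriv fun y => u (y + c) t) = fun y => deriv (fun y => u y t) (y + c) :=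
      funext fun y => deriv_comp_add_const (fun y => u y t) c y
    rw [h1, deriv_comp_add_const (deriv fun y => u y t), hu.heat_eq (x + c) t ht]

lemma sum {ι : Type*} (s : Finset ι) {w : ι → ℝ → ℝ → ℝ}
    (hw : ∀ i ∈ s, IsClassicalSolution (w i)) :
    IsClassicalSolution fun x t => ∑ i ∈ s, w i x t := by
  classical
  induction s using Finset.induction_on with
  | empty => simpa using zero
  | insert i s hi ih =>
    simp_rw [Finset.sum_insert hi]
    exact (hw i (Finset.mem_insert_self i s)).add
      (ih fun j hj => hw j (Finset.mem_insert_of_mem hj))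

end IsClassicalSolution

lemma deriv_deriv_nonpos_of_isLocalMax {g : ℝ → ℝ} {x : ℝ} (hg : ContinuousAt g x)
    (h : IsLocalMax g x) : deriv (deriv g) x ≤ 0 := by
  by_contra! hpos
  have hmin := isLocalMin_of_deriv_deriv_pos hpos h.deriv_eq_zero hg
  have hc : g =ᶠ[𝓝 x] fun _ => g x := by
    filter_upwards [h, hmin] with y h1 h2 using le_antisymm h1 h2
  have := hc.deriv.deriv_eq
  simp only [deriv_const', deriv_const] at this
  linarith

lemma deriv_nonneg_of_eventually_le_left {g : ℝ → ℝ} {t : ℝ} (hg : DifferentiableAt ℝ g t)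
    (h : ∀ᶠ s in 𝓝[<] t, g s ≤ g t) : 0 ≤ deriv g t := by
  have h1 : Tendsto (slope g t) (𝓝[<] t) (𝓝 (deriv g t)) :=
    (hasDerivAt_iff_tendsto_slope.1 hg.hasDerivAt).mono_left
      (nhdsWithin_mono t fun s hs => ne_of_lt hs)
  refine ge_of_tendsto h1 ?_
  filter_upwards [h, self_mem_nhdsWithin] with s hs hst
  rw [slope_def_field]
  exact div_nonneg_of_nonpos (sub_nonpos.2 hs) (sub_nonpos.2 (le_of_lt hst))

/-- The weak maximum principle on a rectangle, with the strict supersolution `ε (x² + 3 t)` as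
barrier. -/
lemma IsClassicalSolution.le_barrier {v : ℝ → ℝ → ℝ} (hv : IsClassicalSolution v)
    {R τ T ε M : ℝ} (hτ : 0 < τ) (hε : 0 < ε)
    (hbot : ∀ x ∈ Icc (-R) R, v x τ ≤ M)
    (hside : ∀ x t, |x| = R → t ∈ Icc τ T → v x t ≤ M + ε * R ^ 2)
    {x t : ℝ} (hx : x ∈ Icc (-R) R) (ht : t ∈ Icc τ T) :
    v x t ≤ M + ε * (x ^ 2 + 3 * t) := by
  set w : ℝ × ℝ → ℝ := fun p => v p.1 p.2 - ε * (p.1 ^ 2 + 3 * p.2) with hw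
  have hwc : ContinuousOn w (Icc (-R) R ×ˢ Icc τ T) := by
    refine (hv.continuousOn.mono ?_).sub (by fun_prop)
    exact fun p hp => ⟨mem_univ _, hτ.trans_le hp.2.1⟩
  obtain ⟨⟨x₀, t₀⟩, ⟨hx₀, ht₀⟩, hmax⟩ :=
    (isCompact_Icc.prod isCompact_Icc).exists_isMaxOn ⟨(x, t), hx, ht⟩ hwc
  have hmax' : ∀ y ∈ Icc (-R) R, ∀ s ∈ Icc τ T,
      v y s - ε * (y ^ 2 + 3 * s) ≤ v x₀ t₀ - ε * (x₀ ^ 2 + 3 * t₀) :=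
    fun y hy s hs => hmax (⟨hy, hs⟩ : (y, s) ∈ Icc (-R) R ×ˢ Icc τ T)
  suffices H : v x₀ t₀ - ε * (x₀ ^ 2 + 3 * t₀) ≤ M by linarith [hmax' x hx t ht]
  by_contra! hlt
  have ht0 : 0 < t₀ := hτ.trans_le ht₀.1
  have hpos : 0 ≤ ε * (x₀ ^ 2 + 3 * t₀) := by positivity
  have hτt : τ < t₀ := lt_of_le_of_ne ht₀.1 fun h => by
    subst h
    linarith [hbot x₀ hx₀]
  have hne : |x₀| ≠ R := fun h => by
    have h1 := hside x₀ t₀ h ht₀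
    rw [← h, sq_abs] at h1
    nlinarith
  have hxlt : |x₀| < R := lt_of_le_of_ne (abs_le.2 hx₀) hne
  have hx' : x₀ ∈ Ioo (-R) R := abs_lt.1 hxlt
  -- the time derivative of `v - ε (x² + 3 t)` is nonnegative at the maximum point
  have htime : 3 * ε ≤ deriv (fun s => v x₀ s) t₀ := by
    have hd := (hv.differentiableAt_time x₀ ht0).hasDerivAt.sub
      ((((hasDerivAt_id t₀).const_mul 3).const_add (x₀ ^ 2)).const_mul ε)
    have h0 := deriv_nonneg_of_eventually_le_left hd.differentiableAt (by
      filter_upwards [Ioo_mem_nhdsLT hτt] with s hs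
      exact hmax' x₀ hx₀ s ⟨hs.1.le, hs.2.le.trans ht₀.2⟩)
    rw [hd.deriv] at h0
    linarith
  -- the second space derivative is nonpositive there
  have hspace : deriv (deriv fun y => v y t₀) x₀ ≤ 2 * ε := by
    have hq : ∀ y, HasDerivAt (fun y : ℝ => ε * (y ^ 2 + 3 * t₀)) (2 * ε * y) y := fun y => by
      refine ((((hasDerivAt_id y).fun_pow 2).add_const (3 * t₀)).const_mul ε).congr_deriv ?_
      simp only [id, Nat.cast_ofNat]
      ring
    have hd1 : (deriv fun y => v y t₀ - ε * (y ^ 2 + 3 * t₀)) =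
        fun y => deriv (fun y => v y t₀) y - 2 * ε * y :=
      funext fun y => ((hv.differentiable_space ht0 y).hasDerivAt.sub (hq y)).deriv
    have hd2 : deriv (deriv fun y => v y t₀ - ε * (y ^ 2 + 3 * t₀)) x₀ =
        deriv (deriv fun y => v y t₀) x₀ - 2 * ε := by
      rw [hd1]
      refine ((hv.differentiable_deriv_space ht0 x₀).hasDerivAt.sub
        ((hasDerivAt_id x₀).const_mul (2 * ε))).deriv.trans ?_
      ring
    have hloc : IsLocalMax (fun y => v y t₀ - ε * (y ^ 2 + 3 * t₀)) x₀ := by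
      filter_upwards [Ioo_mem_nhds hx'.1 hx'.2] with y hy
      exact hmax' y ⟨hy.1.le, hy.2.le⟩ t₀ ht₀
    have hcont : Continuous fun y => v y t₀ - ε * (y ^ 2 + 3 * t₀) :=
      (hv.continuous_space ht0).sub (by fun_prop)
    have := deriv_deriv_nonpos_of_isLocalMax hcont.continuousAt hloc
    linarith
  linarith [hv.heat_eq x₀ t₀ ht0]

/-- The space averages `∫ y in x..(x + h), v y t` of a classical solution are limits of Riemann
sums, uniformly on rectangles, and these Riemann sums are classical solutions. -/
lemma IsClassicalSolution.exists_approx_average {v : ℝ → ℝ → ℝ} (hv : IsClassicalSolution v)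
    {R τ T h η : ℝ} (hτ : 0 < τ) (hh : 0 < h) (hη : 0 < η) :
    ∃ S, IsClassicalSolution S ∧ ∀ x ∈ Icc (-R) R, ∀ t ∈ Icc τ T,
      |(∫ y in x..(x + h), v y t) - S x t| ≤ η := by
  have hK : IsCompact (Icc (-R) (R + h) ×ˢ Icc τ T) := isCompact_Icc.prod isCompact_Icc
  have huc := hK.uniformContinuousOn_of_continuous
    (hv.continuousOn.mono fun p hp => ⟨mem_univ _, hτ.trans_le hp.2.1⟩)
  obtain ⟨δ, hδ, hδ'⟩ := Metric.uniformContinuousOn_iff.1 huc (η / h) (by positivity)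
  obtain ⟨n, hn⟩ := exists_nat_gt (h / δ)
  have hn0 : (0 : ℝ) < n := (by positivity : 0 < h / δ).trans hn
  set d : ℝ := h / n with hd_def
  have hd : 0 < d := by positivity
  have hdδ : d < δ := by
    rw [hd_def, div_lt_iff₀ hn0, mul_comm]
    rwa [div_lt_iff₀ hδ] at hn
  have hnd : n * d = h := by rw [hd_def]; field_simp
  refine ⟨fun x t => ∑ i ∈ Finset.range n, d * v (x + i * d) t,
    IsClassicalSolution.sum _ fun i _ => (hv.translate _).const_mul d, fun x hx t ht => ?_⟩
  have ht0 : 0 < t := hτ.trans_le ht.1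
  have hc := hv.continuous_space ht0
  have hsplit : ∫ y in x..(x + h), v y t =
      ∑ i ∈ Finset.range n, ∫ y in (x + i * d)..(x + (i + 1 : ℕ) * d), v y t := by
    rw [intervalIntegral.sum_integral_adjacent_intervals (a := fun i : ℕ => x + i * d)
      fun i _ => hc.intervalIntegrable _ _]
    simp [hnd]
  rw [hsplit, ← Finset.sum_sub_distrib]
  have hterm : ∀ i ∈ Finset.range n,
      |(∫ y in (x + i * d)..(x + (i + 1 : ℕ) * d), v y t) - d * v (x + i * d) t| ≤ η / h * d := by
    intro i hi
    have hi' : (i : ℝ) + 1 ≤ n := by exact_mod_cast Finset.mem_range.1 hi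
    have hlen : x + (i + 1 : ℕ) * d - (x + i * d) = d := by push_cast; ring
    have hle : x + i * d ≤ x + (i + 1 : ℕ) * d := by linarith
    have e : (∫ y in (x + i * d)..(x + (i + 1 : ℕ) * d), v y t) - d * v (x + i * d) t =
        ∫ y in (x + i * d)..(x + (i + 1 : ℕ) * d), (v y t - v (x + i * d) t) := by
      rw [intervalIntegral.integral_sub (hc.intervalIntegrable _ _) (by simp),
        intervalIntegral.integral_const, hlen, smul_eq_mul]
    rw [e, ← Real.norm_eq_abs]
    refine (intervalIntegral.norm_integral_le_of_norm_le_const (C := η / h) fun y hy => ?_).trans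
      (by rw [hlen, abs_of_pos hd])
    rw [uIoc_of_le hle] at hy
    have hid : 0 ≤ i * d := by positivity
    have hid' : ((i : ℝ) + 1) * d ≤ h := hnd ▸ by gcongr
    have hy2 : y ≤ x + i * d + d := by linarith [hy.2]
    have m1 : (y, t) ∈ Icc (-R) (R + h) ×ˢ Icc τ T :=
      ⟨⟨by linarith [hx.1, hy.1], by linarith [hx.2]⟩, ht⟩
    have m2 : (x + i * d, t) ∈ Icc (-R) (R + h) ×ˢ Icc τ T :=
      ⟨⟨by linarith [hx.1], by linarith [hx.2]⟩, ht⟩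
    refine (hδ' _ m1 _ m2 ?_).le
    rw [Prod.dist_eq, dist_self, Real.dist_eq, abs_of_nonneg (by linarith [hy.1])]
    exact max_lt (by linarith) hδ
  calc _ ≤ ∑ i ∈ Finset.range n, η / h * d :=
        (Finset.abs_sum_le_sum_abs _ _).trans (Finset.sum_le_sum hterm)
    _ = η := by
        rw [Finset.sum_const, Finset.card_range, nsmul_eq_mul, mul_left_comm, hnd]
        field_simp

lemma IsClassicalSolution.average_le_barrier {v : ℝ → ℝ → ℝ} (hv : IsClassicalSolution v)
    {R τ T ε M h : ℝ} (hτ : 0 < τ) (hε : 0 < ε) (hh : 0 < h)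
    (hbot : ∀ x ∈ Icc (-R) R, ∫ y in x..(x + h), v y τ ≤ M)
    (hside : ∀ x t, |x| = R → t ∈ Icc τ T → ∫ y in x..(x + h), v y t ≤ M + ε * R ^ 2)
    {x t : ℝ} (hx : x ∈ Icc (-R) R) (ht : t ∈ Icc τ T) :
    ∫ y in x..(x + h), v y t ≤ M + ε * (x ^ 2 + 3 * t) := by
  refine le_of_forall_pos_le_add fun η hη => ?_
  obtain ⟨S, hS, hap⟩ := hv.exists_approx_average (R := R) (T := T) hτ hh (half_pos hη)
  have hτT : τ ∈ Icc τ T := ⟨le_rfl, ht.1.trans ht.2⟩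
  have := hS.le_barrier (M := M + η / 2) (T := T) hτ hε
    (fun y hy => by linarith [hbot y hy, abs_le.1 (hap y hy τ hτT)])
    (fun y s hy hs => by
      linarith [hside y s hy hs, abs_le.1 (hap y (abs_le.1 hy.le) s hs)]) hx ht
  linarith [abs_le.1 (hap x hx t ht)]

/-- If the space averages of a classical solution over intervals of length `h` are bounded, and
tend uniformly to zero as `t → 0⁺`, then they are nonpositive. -/
lemma IsClassicalSolution.average_nonpos {v : ℝ → ℝ → ℝ} (hv : IsClassicalSolution v)
    {h K : ℝ} {N : ℝ → ℝ} (hh : 0 < h)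
    (hK : ∀ x t, 0 < t → ∫ y in x..(x + h), v y t ≤ K)
    (hN : ∀ x t, 0 < t → ∫ y in x..(x + h), v y t ≤ N t)
    (hlim : Tendsto N (𝓝[>] 0) (𝓝 0)) (x : ℝ) {t : ℝ} (ht : 0 < t) :
    ∫ y in x..(x + h), v y t ≤ 0 := by
  suffices H : ∀ τ, 0 < τ → τ ≤ t → ∫ y in x..(x + h), v y t ≤ max (N τ) 0 by
    have hlim' : Tendsto (fun τ => max (N τ) 0) (𝓝[>] 0) (𝓝 0) := by
      simpa using hlim.max (tendsto_const_nhds (x := (0 : ℝ)))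
    refine ge_of_tendsto hlim' ?_
    filter_upwards [Ioc_mem_nhdsGT ht] with τ hτ using H τ hτ.1 hτ.2
  intro τ hτ hτt
  have hbar : ∀ ε > 0, ∫ y in x..(x + h), v y t ≤ max (N τ) 0 + ε * (x ^ 2 + 3 * t) := by
    intro ε hε
    -- the rectangle is so wide that the barrier dominates `K` on its lateral sides
    set R : ℝ := max |x| √(|K| / ε)
    have hR0 : 0 ≤ √(|K| / ε) := Real.sqrt_nonneg _
    have hR : K ≤ ε * R ^ 2 := by
      have h1 : |K| / ε ≤ R ^ 2 := by
        rw [← Real.sq_sqrt (by positivity : 0 ≤ |K| / ε)]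
        gcongr
        exact le_max_right _ _
      rw [div_le_iff₀ hε] at h1
      linarith [le_abs_self K]
    refine hv.average_le_barrier (R := R) (T := t) hτ hε hh
      (fun y _ => (hN y τ hτ).trans (le_max_left _ _))
      (fun y s _ hs => (hK y s (hτ.trans_le hs.1)).trans ?_)
      (abs_le.1 (le_max_left _ _)) ⟨hτt, le_rfl⟩
    linarith [le_max_right (N τ) 0]
  have hc : Tendsto (fun ε : ℝ => max (N τ) 0 + ε * (x ^ 2 + 3 * t)) (𝓝[>] 0)
      (𝓝 (max (N τ) 0 + 0 * (x ^ 2 + 3 * t))) :=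
    (Continuous.tendsto (by fun_prop) 0).mono_left nhdsWithin_le_nhds
  rw [zero_mul, add_zero] at hc
  exact ge_of_tendsto hc (eventually_mem_nhdsWithin.mono hbar)

lemma IsClassicalSolution.eq_zero_of_average {v : ℝ → ℝ → ℝ} (hv : IsClassicalSolution v)
    {K : ℝ} {N : ℝ → ℝ}
    (hK : ∀ x y t, x < y → 0 < t → |∫ s in x..y, v s t| ≤ K)
    (hN : ∀ x y t, x < y → 0 < t → |∫ s in x..y, v s t| ≤ N t)
    (hlim : Tendsto N (𝓝[>] 0) (𝓝 0)) (x : ℝ) {t : ℝ} (ht : 0 < t) : v x t = 0 := by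
  have hzero : ∀ y, x - 1 < y → ∫ s in (x - 1)..y, v s t = 0 := by
    intro y hy
    have hh : 0 < y - (x - 1) := sub_pos.2 hy
    have e : x - 1 + (y - (x - 1)) = y := by ring
    refine le_antisymm ?_ ?_
    · have := hv.average_nonpos hh
        (fun z s hs => (le_abs_self _).trans (hK z _ s (by linarith) hs))
        (fun z s hs => (le_abs_self _).trans (hN z _ s (by linarith) hs)) hlim (x - 1) ht
      rwa [e] at this
    · have hneg : ∀ z s : ℝ, ∫ r in z..(z + (y - (x - 1))), -1 * v r s =
          -∫ r in z..(z + (y - (x - 1))), v r s := fun z s => by simp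
      have := (hv.const_mul (-1)).average_nonpos hh
        (fun z s hs => (hneg z s).trans_le ((neg_le_abs _).trans (hK z _ s (by linarith) hs)))
        (fun z s hs => (hneg z s).trans_le ((neg_le_abs _).trans (hN z _ s (by linarith) hs)))
        hlim (x - 1) ht
      rw [hneg, e] at this
      linarith
  have hc := hv.continuous_space ht
  have hd : HasDerivAt (fun y => ∫ s in (x - 1)..y, v s t) (v x t) x :=
    intervalIntegral.integral_hasDerivAt_right (hc.intervalIntegrable _ _)
      (hc.stronglyMeasurableAtFilter _ _) hc.continuousAt
  refine hd.unique ((hasDerivAt_const x (0 : ℝ)).congr_of_eventuallyEq ?_)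
  filter_upwards [Ioi_mem_nhds (sub_one_lt x)] with y hy using hzero y hy

lemma IsAlexSolution.unique {f : Distr} (hf : f ∈ Ac) {u v : ℝ → ℝ → ℝ}
    (hu : IsAlexSolution f u) (hv : IsAlexSolution f v) (x : ℝ) {t : ℝ} (ht : 0 < t) :
    u x t = v x t := by
  obtain ⟨F, hF⟩ := hf
  obtain ⟨K₁, hK₁⟩ := hu.bounded
  obtain ⟨K₂, hK₂⟩ := hv.bounded
  have hint : ∀ x y t, 0 < t → ∫ s in x..y, (u s t - v s t) =
      (∫ s in x..y, u s t) - ∫ s in x..y, v s t := fun x y t ht =>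
    intervalIntegral.integral_sub ((hu.classical.continuous_space ht).intervalIntegrable _ _)
      ((hv.classical.continuous_space ht).intervalIntegrable _ _)
  refine sub_eq_zero.1 ((hu.classical.sub hv.classical).eq_zero_of_average (K := K₁ + K₂)
    (N := fun t => alexNorm (ofFun (fun x => u x t) - f) + alexNorm (ofFun (fun x => v x t) - f))
    (fun x y t hxy ht => ?_) (fun x y t hxy ht => ?_) (by simpa using hu.initial.add hv.initial)
    x ht)
  all_goals
    obtain ⟨P, hP⟩ := hu.mem_Ac t ht
    obtain ⟨Q, hQ⟩ := hv.mem_Ac t ht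
    rw [hint x y t ht, ← hP.sub_eq_integral (hu.classical.continuous_space ht),
      ← hQ.sub_eq_integral (hv.classical.continuous_space ht)]
  · exact (abs_sub _ _).trans (add_le_add ((hP.abs_sub_le_alexNorm hxy).trans (hK₁ t ht))
      ((hQ.abs_sub_le_alexNorm hxy).trans (hK₂ t ht)))
  · have e : P y - P x - (Q y - Q x) = (P y - F y - (P x - F x)) - (Q y - F y - (Q x - F x)) := by
      ring
    rw [e]
    exact (abs_sub _ _).trans (add_le_add ((hP.sub hF).abs_sub_le_alexNorm hxy)
      ((hQ.sub hF).abs_sub_le_alexNorm hxy))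

end AlexHeat

end

theorem theorem5p3 (f : AlexHeat.Distr) (hf : f ∈ AlexHeat.Ac) :
    AlexHeat.IsAlexSolution f (fun x t => AlexHeat.heatConv f x t) ∧
    ∀ u : ℝ → ℝ → ℝ, AlexHeat.IsAlexSolution f u →
      ∀ x t : ℝ, 0 < t → u x t = AlexHeat.heatConv f x t := by
  obtain ⟨F, hF⟩ := id hf
  have hsol := AlexHeat.isAlexSolution_heatConv hF
  exact ⟨hsol, fun u hu x t ht => hu.unique hf hsol x ht⟩
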